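/- Let $(M,J)$ be a complex manifold of complex dimension $n$ with an arbitrary Hermitian metric $g$ (a smooth $J$-invariant Riemannian metric), let $\omega=g(J\cdot,\cdot)$ be its Hermitian form, and put $d^c\omega=-d\omega(J\cdot,J\cdot,J\cdot)$. Let $\nabla^B=\nabla^g-\tfrac12 g^{-1}d^c\omega$ be the Bismut connection, where $\nabla^g$ is the Levi-Civita connection and $g^{-1}d^c\omega(X,Y):=g^{-1}(d^c\omega(X,Y,\cdot))$. Let $F$ be the curvature of the connection that $\nabla^B$ induces on the anticanonical bundle $K_M^{-1}=\Lambda^nT^{1,0}$, and let $\rho_B=iF$ be the Bismut Ricci form, with $(2,0)$-part $\rho_B^{2,0}$. All tensors are extended complex multilinearly to $T\otimes\mathbb C$. In local holomorphic coordinates $z_1,\dots,z_n$ on $M$, define the torsion bivector field by $$\sigma_\omega=\sum_{k=1}^n\Big[g^{-1}d\bar z_k,\ (g^{-1}\otimes g^{-1})\big(\iota_{\bar\partial_k}\,i\partial\omega\big)\Big]^{0,2},\qquad \bar\partial_k=\frac{\partial}{\partial\bar z_k},$$ where $[\cdot,\cdot]$ is the Schouten bracket of a vector field with a bivector field (the Lie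 derivative), $\partial\omega=(d\omega)^{2,1}$, and the superscript $0,2$ denotes the component in $\Lambda^2T^{0,1}$. Then, in all local holomorphic coordinates and at every point of their domain, $$\sigma_\omega=i\,(g^{-1}\otimes g^{-1})\rho_B^{2,0},$$ or equivalently $\sigma_\omega=-(g^{-1}\otimes g^{-1})F^{2,0}$ with $F=-i\rho_B$. -/

import Mathlib

open scoped Manifold ContDiff

noncomputable section

namespace HermitianGeometry

/-- A Hermitian metric on a complex manifold `M` of dimension `n`: a smooth Riemannian metric that is
invariant under the complex structure `J = multiplication by i` of the (real) tangent spaces.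
Smoothness is `C^∞` over `ℝ` of the components in every holomorphic chart. -/
structure HermitianMetric (n : ℕ) (M : Type*) [TopologicalSpace M]
    [ChartedSpace (Fin n → ℂ) M] where
  /-- the inner product on each tangent space -/
  inner : ∀ p : M, TangentSpace 𝓘(ℂ, Fin n → ℂ) p →ₗ[ℝ] TangentSpace 𝓘(ℂ, Fin n → ℂ) p →ₗ[ℝ] ℝ
  symm : ∀ (p : M) (v w : TangentSpace 𝓘(ℂ, Fin n → ℂ) p), inner p v w = inner p w v
  pos : ∀ (p : M) (v : TangentSpace 𝓘(ℂ, Fin n → ℂ) p), v ≠ 0 → 0 < inner p v v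
  invariant : ∀ (p : M) (v w : TangentSpace 𝓘(ℂ, Fin n → ℂ) p),
    inner p (Complex.I • v) (Complex.I • w) = inner p v w
  smooth : ∀ φ ∈ IsManifold.maximalAtlas 𝓘(ℂ, Fin n → ℂ) ω M, ∀ v w : Fin n → ℂ,
    ContDiffOn ℝ ∞ (fun x : Fin n → ℂ =>
      inner (φ.symm x)
        (mfderiv 𝓘(ℂ, Fin n → ℂ) 𝓘(ℂ, Fin n → ℂ) φ.symm x v)
        (mfderiv 𝓘(ℂ, Fin n → ℂ) 𝓘(ℂ, Fin n → ℂ) φ.symm x w)) φ.target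

/-! ### The coordinate frame of the complexified tangent bundle

Holomorphic coordinates `z_1, …, z_n` give the commuting frame
`∂_1, …, ∂_n, ∂̄_1, …, ∂̄_n` of `T ⊗ ℂ`. All tensors are extended complex multilinearly and
written in this frame. -/

/-- Frame indices: `inl j` stands for `∂_j = ∂/∂z_j`, `inr j` for `∂̄_j = ∂/∂z̄_j`. -/
abbrev Idx (n : ℕ) : Type := Fin n ⊕ Fin n

variable {n : ℕ}

/-- The coordinate number of a frame index. -/
def Idx.pos (a : Idx n) : Fin n := Sum.elim id id a

/-- The eigenvalue of `J` on a frame vector: `J ∂_j = i ∂_j` and `J ∂̄_j = -i ∂̄_j`. -/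
def jEig (a : Idx n) : ℂ := Sum.elim (fun _ => Complex.I) (fun _ => -Complex.I) a

/-- The real coordinate vector `∂/∂x_j`, where `z_j = x_j + i y_j` and `j = a.pos`. -/
def xVec (a : Idx n) : Fin n → ℂ := Pi.single a.pos 1

/-- The real coordinate vector `∂/∂y_j`, where `z_j = x_j + i y_j` and `j = a.pos`. -/
def yVec (a : Idx n) : Fin n → ℂ := Pi.single a.pos Complex.I

/-- The derivative of a complex function along the frame vector `a`:
`∂_j = (∂/∂x_j - i ∂/∂y_j) / 2` and `∂̄_j = (∂/∂x_j + i ∂/∂y_j) / 2`. -/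
def frameDeriv (a : Idx n) (f : (Fin n → ℂ) → ℂ) (x : Fin n → ℂ) : ℂ :=
  (fderiv ℝ f x (xVec a) - jEig a * fderiv ℝ f x (yVec a)) / 2

namespace HermitianMetric

variable {M : Type*} [TopologicalSpace M] [ChartedSpace (Fin n → ℂ) M]
  (g : HermitianMetric n M) (φ : OpenPartialHomeomorph M (Fin n → ℂ))

/-- The metric read in the coordinates `φ`, on real tangent vectors of `ℂⁿ` at `x`. -/
def localInner (x v w : Fin n → ℂ) : ℝ :=
  g.inner (φ.symm x)
    (mfderiv 𝓘(ℂ, Fin n → ℂ) 𝓘(ℂ, Fin n → ℂ) φ.symm x v)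
    (mfderiv 𝓘(ℂ, Fin n → ℂ) 𝓘(ℂ, Fin n → ℂ) φ.symm x w)

/-- The components `g_{ab} = g(e_a, e_b)` of the complex bilinear extension of the metric, where
`e_a = (∂/∂x_a - J_a ∂/∂y_a) / 2`. -/
def coeff (x : Fin n → ℂ) : Matrix (Idx n) (Idx n) ℂ :=
  Matrix.of fun a b =>
    ((g.localInner φ x (xVec a) (xVec b) : ℂ)
      - jEig b * (g.localInner φ x (xVec a) (yVec b) : ℂ)
      - jEig a * (g.localInner φ x (yVec a) (xVec b) : ℂ)
      + jEig a * jEig b * (g.localInner φ x (yVec a) (yVec b) : ℂ)) / 4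

/-- The components `g^{ab}` of the inverse metric. -/
def invCoeff (x : Fin n → ℂ) (a b : Idx n) : ℂ := (g.coeff φ x)⁻¹ a b

/-- The Christoffel symbols of the Levi-Civita connection:
`∇^g_{e_a} e_b = ∑_c Γ^c_{ab} e_c`, with `Γ^c_{ab}` written `leviCivita x a b c`. -/
def leviCivita (x : Fin n → ℂ) (a b c : Idx n) : ℂ :=
  ∑ d, g.invCoeff φ x c d *
    ((frameDeriv a (fun y => g.coeff φ y b d) x + frameDeriv b (fun y => g.coeff φ y a d) x
      - frameDeriv d (fun y => g.coeff φ y a b) x) / 2)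

/-- The Hermitian form `ω = g(J ·, ·)`. -/
def hermitianForm (x : Fin n → ℂ) (a b : Idx n) : ℂ := jEig a * g.coeff φ x a b

/-- The exterior derivative `dω`. -/
def dOmega (x : Fin n → ℂ) (a b c : Idx n) : ℂ :=
  frameDeriv a (fun y => g.hermitianForm φ y b c) x
    - frameDeriv b (fun y => g.hermitianForm φ y a c) x
    + frameDeriv c (fun y => g.hermitianForm φ y a b) x

/-- The three-form `d^c ω = -dω(J ·, J ·, J ·)`. -/
def dcOmega (x : Fin n → ℂ) (a b c : Idx n) : ℂ :=
  -(jEig a * jEig b * jEig c * g.dOmega φ x a b c)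

/-- The three-form `∂ω`, that is, the `(2,1)`-part of `dω`: it keeps the components with exactly
two indices of type `(1,0)`. -/
def delOmega (x : Fin n → ℂ) (a b c : Idx n) : ℂ :=
  if a.isLeft.toNat + b.isLeft.toNat + c.isLeft.toNat = 2 then g.dOmega φ x a b c else 0

/-- The connection coefficients of the Bismut connection `∇^B = ∇^g - (1/2) g⁻¹ d^c ω`:
`∇^B_{e_a} e_b = ∑_c B^c_{ab} e_c`, with `B^c_{ab}` written `bismut x a b c`. -/
def bismut (x : Fin n → ℂ) (a b c : Idx n) : ℂ :=
  g.leviCivita φ x a b c - (1 / 2) * ∑ d, g.invCoeff φ x c d * g.dcOmega φ x a b d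

/-- The connection form induced by the Bismut connection on the anticanonical bundle
`K_M⁻¹ = Λⁿ T^{1,0}` in the frame `∂_1 ∧ ⋯ ∧ ∂_n`:
`∇^B_{e_a} (∂_1 ∧ ⋯ ∧ ∂_n) = A_a ∂_1 ∧ ⋯ ∧ ∂_n`. -/
def anticanonicalForm (x : Fin n → ℂ) (a : Idx n) : ℂ :=
  ∑ j : Fin n, g.bismut φ x a (Sum.inl j) (Sum.inl j)

/-- The curvature `F = dA` of the connection induced by the Bismut connection on `K_M⁻¹`. -/
def anticanonicalCurvature (x : Fin n → ℂ) (a b : Idx n) : ℂ :=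
  frameDeriv a (fun y => g.anticanonicalForm φ y b) x
    - frameDeriv b (fun y => g.anticanonicalForm φ y a) x

/-- The Bismut Ricci form `ρ_B = i F`. -/
def bismutRicci (x : Fin n → ℂ) (a b : Idx n) : ℂ :=
  Complex.I * g.anticanonicalCurvature φ x a b

/-- `(g⁻¹ ⊗ g⁻¹) τ`: raise both indices of a covariant two-tensor. -/
def raise (x : Fin n → ℂ) (τ : Idx n → Idx n → ℂ) (a b : Idx n) : ℂ :=
  ∑ c, ∑ d, g.invCoeff φ x a c * g.invCoeff φ x b d * τ c d

/-- The vector field `g⁻¹ dz̄_k`, a section of `T^{1,0}`. -/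
def sharpDzBar (k : Fin n) (x : Fin n → ℂ) (a : Idx n) : ℂ := g.invCoeff φ x a (Sum.inr k)

/-- The bivector field `(g⁻¹ ⊗ g⁻¹)(ι_{∂̄_k} i∂ω)`. -/
def torsionBivectorAlong (k : Fin n) (x : Fin n → ℂ) : Idx n → Idx n → ℂ :=
  g.raise φ x fun a b => Complex.I * g.delOmega φ x (Sum.inr k) a b

end HermitianMetric

/-- The Schouten bracket `[w, β]` of a complex vector field `w = ∑ w^a e_a` with a complex bivector
field `β = ½ ∑ β^{ab} e_a ∧ e_b`, i.e. the Lie derivative of `β` along `w`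
(`[w, u ∧ v] = [w, u] ∧ v + u ∧ [w, v]`), in components. -/
def schouten (w : (Fin n → ℂ) → Idx n → ℂ) (β : (Fin n → ℂ) → Idx n → Idx n → ℂ)
    (x : Fin n → ℂ) (a b : Idx n) : ℂ :=
  ∑ c, (w x c * frameDeriv c (fun y => β y a b) x
    - β x c b * frameDeriv c (fun y => w y a) x
    - β x a c * frameDeriv c (fun y => w y b) x)

/-- The `(0,2)`-part of a bivector. -/
def part02 (β : Idx n → Idx n → ℂ) (a b : Idx n) : ℂ :=
  if a.isRight ∧ b.isRight then β a b else 0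

/-- The `(2,0)`-part of a two-form. -/
def part20 (τ : Idx n → Idx n → ℂ) (a b : Idx n) : ℂ :=
  if a.isLeft ∧ b.isLeft then τ a b else 0

/-- The torsion bivector field
`σ_ω = ∑_k [g⁻¹ dz̄_k, (g⁻¹ ⊗ g⁻¹)(ι_{∂̄_k} i∂ω)]^{0,2}` in the coordinates `φ`. -/
def HermitianMetric.torsionBivector {M : Type*} [TopologicalSpace M]
    [ChartedSpace (Fin n → ℂ) M] (g : HermitianMetric n M)
    (φ : OpenPartialHomeomorph M (Fin n → ℂ)) (x : Fin n → ℂ) (a b : Idx n) : ℂ :=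
  ∑ k, part02 (schouten (g.sharpDzBar φ k) (g.torsionBivectorAlong φ k) x) a b

end HermitianGeometry

end

noncomputable section

namespace HermitianGeometry

variable {n : ℕ} {M : Type*} [TopologicalSpace M] [ChartedSpace (Fin n → ℂ) M]
  (g : HermitianMetric n M) (φ : OpenPartialHomeomorph M (Fin n → ℂ))

/-! ### The metric in holomorphic coordinates -/

namespace HermitianMetric

/-! Everything reduces to the matrix `H j k = g(∂_j, ∂̄_k)`, called `mixedCoeff`, and its inverse
`K`: invariance under `J` kills the pure blocks of `g`, so raising indices exchanges the types (1,0)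
and (0,1). Put `P c = ∂_c H` and `T_k d e = ∂_d H e k - ∂_e H d k` (`chernTorsion`).

On one side, contracting `i∂ω` with `∂̄_k` gives `-T_k`, and `g⁻¹ dz̄_k = ∑_c K k c ∂_c` has no
(0,1)-components, so the (0,2)-part of the bracket merely differentiates the components of `-K T_k
Kᵀ`. Since `∂_c K = -K (P c) K`, the result is `σ = -K S Kᵀ` with `S = ∑ K k c (∂_c T_k - (P c) K
T_k - T_k ((P c) K)ᵀ)` (`torsionBivector_eq`).

On the other side, the Levi-Civita and torsion terms of the Bismut connection combine to `A_a = ∑ K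
l j ∂_j H a l` (`anticanonicalForm_inl`). As `i · i = -1`, the theorem becomes `F^{2,0} = S`
(`anticanonicalCurvature_inl_inl`): the second derivatives of `H` agree because partial derivatives
commute, the quadratic terms by the index identity `sum_torsion_quadratic`. -/

theorem localInner_add_right (x v w w' : Fin n → ℂ) :
    g.localInner φ x v (w + w') = g.localInner φ x v w + g.localInner φ x v w' := by
  simp only [localInner]
  rw [← map_add]
  congr 1
  exact map_add (mfderiv 𝓘(ℂ, Fin n → ℂ) 𝓘(ℂ, Fin n → ℂ) φ.symm x) _ _

theorem localInner_smul_right (x v w : Fin n → ℂ) (r : ℝ) :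
    g.localInner φ x v (r • w) = r * g.localInner φ x v w := by
  simp only [localInner]
  rw [← smul_eq_mul, ← map_smul]
  congr 1
  have := map_smul (mfderiv 𝓘(ℂ, Fin n → ℂ) 𝓘(ℂ, Fin n → ℂ) φ.symm x) (r : ℂ) w
  exact this

theorem localInner_I (x v w : Fin n → ℂ) :
    g.localInner φ x (Complex.I • v) (Complex.I • w) = g.localInner φ x v w := by
  simp only [localInner]
  rw [← g.invariant (φ.symm x) (mfderiv 𝓘(ℂ, Fin n → ℂ) 𝓘(ℂ, Fin n → ℂ) φ.symm x v)]
  congr 1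
  · congr 1
    exact map_smul (mfderiv 𝓘(ℂ, Fin n → ℂ) 𝓘(ℂ, Fin n → ℂ) φ.symm x) Complex.I v
  · exact map_smul (mfderiv 𝓘(ℂ, Fin n → ℂ) 𝓘(ℂ, Fin n → ℂ) φ.symm x) Complex.I w

theorem localInner_pos [IsManifold 𝓘(ℂ, Fin n → ℂ) ω M]
    (hφ : φ ∈ IsManifold.maximalAtlas 𝓘(ℂ, Fin n → ℂ) ω M) {x v : Fin n → ℂ}
    (hx : x ∈ φ.target) (hv : v ≠ 0) :
    0 < g.localInner φ x v v := by
  apply g.pos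
  intro h
  apply hv
  have hd : φ.MDifferentiable 𝓘(ℂ, Fin n → ℂ) 𝓘(ℂ, Fin n → ℂ) :=
    ⟨(contMDiffOn_of_mem_maximalAtlas hφ).mdifferentiableOn (by simp),
      (contMDiffOn_symm_of_mem_maximalAtlas hφ).mdifferentiableOn (by simp)⟩
  have := congrArg (fun L => L v) (hd.comp_symm_deriv hx)
  have h2 := (map_zero (mfderiv 𝓘(ℂ, Fin n → ℂ) 𝓘(ℂ, Fin n → ℂ) φ (φ.symm x)))
  rw [← h] at h2
  exact this.symm.trans h2

theorem localInner_comm (x v w : Fin n → ℂ) : g.localInner φ x v w = g.localInner φ x w v :=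
  g.symm _ _ _

theorem localInner_I_right (x v w : Fin n → ℂ) :
    g.localInner φ x v (Complex.I • w) = -g.localInner φ x (Complex.I • v) w := by
  rw [← localInner_I g φ x v, smul_smul, Complex.I_mul_I]
  have := localInner_smul_right g φ x (Complex.I • v) w (-1)
  simpa using this

theorem yVec_eq (a : Idx n) : yVec a = Complex.I • xVec a := by
  simp [yVec, xVec, ← Pi.single_smul]

/-! ### The mixed block of the metric and its inverse -/

/-- The block `g(∂_j, ∂̄_k)` of the coefficient matrix. -/
def mixedCoeff (x : Fin n → ℂ) : Matrix (Fin n) (Fin n) ℂ :=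
  Matrix.of fun j k => g.coeff φ x (Sum.inl j) (Sum.inr k)

theorem mixedCoeff_apply (x : Fin n → ℂ) (j k : Fin n) :
    g.mixedCoeff φ x j k = ((g.localInner φ x (Pi.single j 1) (Pi.single k 1) : ℂ) +
      Complex.I * (g.localInner φ x (Pi.single j 1) (Complex.I • Pi.single k 1) : ℂ)) / 2 := by
  simp only [mixedCoeff, coeff, Matrix.of_apply, yVec_eq, localInner_I]
  have := localInner_I_right g φ x (Pi.single j 1) (Pi.single k 1)
  simp only [xVec, Idx.pos, jEig, Sum.elim_inl, Sum.elim_inr, id, this]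
  push_cast
  linear_combination (-(g.localInner φ x (Pi.single j 1) (Pi.single k 1) : ℂ)/4) * Complex.I_mul_I

theorem coeff_comm (x : Fin n → ℂ) (a b : Idx n) : g.coeff φ x a b = g.coeff φ x b a := by
  simp only [coeff, Matrix.of_apply]
  rw [localInner_comm g φ x (xVec a) (xVec b), localInner_comm g φ x (xVec a) (yVec b),
    localInner_comm g φ x (yVec a) (xVec b), localInner_comm g φ x (yVec a) (yVec b)]
  ring

theorem coeff_inl_inl (x : Fin n → ℂ) (j k : Fin n) :
    g.coeff φ x (Sum.inl j) (Sum.inl k) = 0 := by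
  simp only [coeff, Matrix.of_apply, yVec_eq, localInner_I]
  rw [localInner_I_right g φ x (xVec (Sum.inl j)) (xVec (Sum.inl k))]
  simp only [jEig, Sum.elim_inl]
  push_cast
  linear_combination (g.localInner φ x (xVec (Sum.inl j)) (xVec (Sum.inl k)) / 4 : ℂ) *
    Complex.I_mul_I

theorem coeff_inr_inr (x : Fin n → ℂ) (j k : Fin n) :
    g.coeff φ x (Sum.inr j) (Sum.inr k) = 0 := by
  simp only [coeff, Matrix.of_apply, yVec_eq, localInner_I]
  rw [localInner_I_right g φ x (xVec (Sum.inr j)) (xVec (Sum.inr k))]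
  simp only [jEig, Sum.elim_inr]
  push_cast
  linear_combination (g.localInner φ x (xVec (Sum.inr j)) (xVec (Sum.inr k)) / 4 : ℂ) *
    Complex.I_mul_I

theorem coeff_inl_inr (x : Fin n → ℂ) (j k : Fin n) :
    g.coeff φ x (Sum.inl j) (Sum.inr k) = g.mixedCoeff φ x j k := rfl

theorem coeff_inr_inl (x : Fin n → ℂ) (j k : Fin n) :
    g.coeff φ x (Sum.inr j) (Sum.inl k) = g.mixedCoeff φ x k j := coeff_comm g φ x _ _

theorem coeff_eq_fromBlocks (x : Fin n → ℂ) :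
    g.coeff φ x = Matrix.fromBlocks 0 (g.mixedCoeff φ x) (g.mixedCoeff φ x).transpose 0 := by
  ext (a | a) (b | b) <;>
    simp [coeff_inl_inl, coeff_inr_inr, coeff_inl_inr, coeff_inr_inl]

theorem localInner_zero_right (x v : Fin n → ℂ) : g.localInner φ x v 0 = 0 := by
  simpa using localInner_smul_right g φ x v 0 0

theorem localInner_sum_right {ι : Type*} (s : Finset ι) (x v : Fin n → ℂ)
    (w : ι → Fin n → ℂ) :
    g.localInner φ x v (∑ i ∈ s, w i) = ∑ i ∈ s, g.localInner φ x v (w i) := by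
  classical
  induction s using Finset.induction_on with
  | empty => simp [localInner_zero_right]
  | insert i s hi ih => rw [Finset.sum_insert hi, Finset.sum_insert hi, localInner_add_right, ih]

theorem localInner_complex_smul_right (x v w : Fin n → ℂ) (c : ℂ) :
    g.localInner φ x v (c • w) =
      c.re * g.localInner φ x v w + c.im * g.localInner φ x v (Complex.I • w) := by
  rw [← localInner_smul_right, ← localInner_smul_right, ← localInner_add_right]
  congr 1
  ext i
  simp only [Pi.add_apply, Pi.smul_apply, smul_eq_mul, Complex.real_smul]
  nth_rewrite 1 [← Complex.re_add_im c]
  ring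

/-- Positivity: a kernel vector of the matrix yields a nonzero real tangent vector orthogonal to
everything, hence to itself. -/
theorem isUnit_det_mixedCoeff [IsManifold 𝓘(ℂ, Fin n → ℂ) ω M]
    (hφ : φ ∈ IsManifold.maximalAtlas 𝓘(ℂ, Fin n → ℂ) ω M) {x : Fin n → ℂ}
    (hx : x ∈ φ.target) : IsUnit (g.mixedCoeff φ x).det := by
  rw [isUnit_iff_ne_zero]
  intro h0
  obtain ⟨c, hc, hc0⟩ := Matrix.exists_mulVec_eq_zero_iff.mpr h0
  -- The conjugate is needed because `g(v, w) + i g(v, iw)` is antilinear in `w`; at `v = e_j` it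
  -- equals `2 ∑ H j k c_k`.
  set w : Fin n → ℂ := fun k => star (c k) with hw
  have hsum : ∀ u : Fin n → ℂ, u = ∑ k, u k • (Pi.single k 1 : Fin n → ℂ) := fun u => by
    ext i; simp [Finset.sum_apply, Pi.single_apply]
  have hwne : w ≠ 0 := fun h => hc <| by
    ext k
    simpa [hw] using congrFun h k
  have key : ∀ j, (g.localInner φ x (Pi.single j 1) w : ℂ) +
      Complex.I * g.localInner φ x (Pi.single j 1) (Complex.I • w) = 0 := by
    intro j
    have hj := congrFun hc0 j
    simp only [Matrix.mulVec, dotProduct, mixedCoeff_apply, Pi.zero_apply] at hj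
    conv_lhs => rw [hsum w]
    rw [Finset.smul_sum, localInner_sum_right, localInner_sum_right]
    push_cast
    rw [Finset.mul_sum, ← Finset.sum_add_distrib, ← mul_zero (2 : ℂ), ← hj, Finset.mul_sum]
    refine Finset.sum_congr rfl fun k _ => ?_
    have hJ : Complex.I • w k • (Pi.single k 1 : Fin n → ℂ) =
        w k • Complex.I • (Pi.single k 1 : Fin n → ℂ) := smul_comm _ _ _
    rw [hJ, localInner_complex_smul_right g φ x _ _ (w k),
      localInner_complex_smul_right g φ x _ _ (w k), smul_smul, Complex.I_mul_I]
    have hneg : g.localInner φ x (Pi.single j 1) ((-1 : ℂ) • Pi.single k 1) =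
        -g.localInner φ x (Pi.single j 1) (Pi.single k 1) := by
      have := localInner_smul_right g φ x (Pi.single j 1) (Pi.single k 1) (-1)
      simpa using this
    rw [hneg]
    simp only [hw, Complex.star_def, Complex.conj_re, Complex.conj_im]
    have hck := Complex.re_add_im (c k)
    push_cast
    linear_combination ((g.localInner φ x (Pi.single j 1) (Pi.single k 1) : ℂ) +
      Complex.I * g.localInner φ x (Pi.single j 1) (Complex.I • Pi.single k 1)) * hck -
      (g.localInner φ x (Pi.single j 1) (Complex.I • Pi.single k 1) : ℂ) *
      (c k).im * Complex.I_mul_I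
  -- The two inner products are real, so they vanish separately; they are the pairings of `w` with
  -- `e_j` and, up to sign, with `i e_j`, which span over the reals.
  have hre : ∀ j, g.localInner φ x (Pi.single j 1) w = 0 := fun j => by
    simpa using congrArg Complex.re (key j)
  have him : ∀ j, g.localInner φ x (Pi.single j 1) (Complex.I • w) = 0 := fun j => by
    simpa using congrArg Complex.im (key j)
  have hpos := localInner_pos g φ hφ hx hwne
  refine hpos.ne' ?_
  have hall : ∀ u, g.localInner φ x w u = 0 := fun u => by
    rw [hsum u, localInner_sum_right]
    refine Finset.sum_eq_zero fun k _ => ?_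
    have hI : g.localInner φ x (Complex.I • Pi.single k 1) w = 0 := by
      rw [← neg_eq_zero, ← localInner_I_right, him]
    rw [localInner_complex_smul_right, localInner_comm g φ x w, hre, localInner_comm g φ x w, hI,
      mul_zero, mul_zero, add_zero]
  exact hall w

theorem coeff_inv [IsManifold 𝓘(ℂ, Fin n → ℂ) ω M]
    (hφ : φ ∈ IsManifold.maximalAtlas 𝓘(ℂ, Fin n → ℂ) ω M) {x : Fin n → ℂ}
    (hx : x ∈ φ.target) :
    (g.coeff φ x)⁻¹ = Matrix.fromBlocks 0 (g.mixedCoeff φ x)⁻¹.transpose (g.mixedCoeff φ x)⁻¹ 0 := by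
  have h := isUnit_det_mixedCoeff g φ hφ hx
  apply Matrix.inv_eq_right_inv
  rw [coeff_eq_fromBlocks, Matrix.fromBlocks_multiply]
  simp only [zero_mul, mul_zero, zero_add, add_zero, Matrix.mul_nonsing_inv _ h,
    ← Matrix.transpose_mul, Matrix.nonsing_inv_mul _ h, Matrix.transpose_one,
    Matrix.fromBlocks_one]

section InverseBlocks

variable [IsManifold 𝓘(ℂ, Fin n → ℂ) ω M]
    (hφ : φ ∈ IsManifold.maximalAtlas 𝓘(ℂ, Fin n → ℂ) ω M) {x : Fin n → ℂ} (hx : x ∈ φ.target)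
    (j k : Fin n)
include hφ hx

theorem invCoeff_inl_inl : g.invCoeff φ x (Sum.inl j) (Sum.inl k) = 0 := by
  simp [invCoeff, coeff_inv g φ hφ hx]

theorem invCoeff_inr_inr : g.invCoeff φ x (Sum.inr j) (Sum.inr k) = 0 := by
  simp [invCoeff, coeff_inv g φ hφ hx]

theorem invCoeff_inl_inr :
    g.invCoeff φ x (Sum.inl j) (Sum.inr k) = (g.mixedCoeff φ x)⁻¹ k j := by
  simp [invCoeff, coeff_inv g φ hφ hx]

theorem invCoeff_inr_inl :
    g.invCoeff φ x (Sum.inr j) (Sum.inl k) = (g.mixedCoeff φ x)⁻¹ j k := by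
  simp [invCoeff, coeff_inv g φ hφ hx]

end InverseBlocks

/-! ### Smoothness of the mixed block and its inverse -/

theorem contDiffOn_mixedCoeff
    (hφ : φ ∈ IsManifold.maximalAtlas 𝓘(ℂ, Fin n → ℂ) ω M) (j k : Fin n) :
    ContDiffOn ℝ ∞ (fun y => g.mixedCoeff φ y j k) φ.target := by
  have h : ∀ v w : Fin n → ℂ, ContDiffOn ℝ ∞ (fun y => (g.localInner φ y v w : ℂ)) φ.target :=
    fun v w => Complex.ofRealCLM.contDiff.comp_contDiffOn (g.smooth φ hφ v w)
  simp only [mixedCoeff_apply]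
  exact ((h _ _).add (contDiffOn_const.mul (h _ _))).div_const _

/-- Cramer's rule: determinant and adjugate are polynomial in the entries, and the determinant has
no zero on the chart. -/
theorem contDiffOn_inv_mixedCoeff [IsManifold 𝓘(ℂ, Fin n → ℂ) ω M]
    (hφ : φ ∈ IsManifold.maximalAtlas 𝓘(ℂ, Fin n → ℂ) ω M) (j k : Fin n) :
    ContDiffOn ℝ ∞ (fun y => (g.mixedCoeff φ y)⁻¹ j k) φ.target := by
  have hdet : ∀ f : (Fin n → ℂ) → Matrix (Fin n) (Fin n) ℂ,
      (∀ i l, ContDiffOn ℝ ∞ (fun y => f y i l) φ.target) →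
      ContDiffOn ℝ ∞ (fun y => (f y).det) φ.target := fun f hf => by
    simp only [Matrix.det_apply]
    exact ContDiffOn.sum fun τ _ => (contDiffOn_prod fun i _ => hf _ _).const_smul _
  have hadj : ContDiffOn ℝ ∞ (fun y => (g.mixedCoeff φ y).adjugate j k) φ.target := by
    simp only [Matrix.adjugate_apply]
    refine hdet _ fun i l => ?_
    by_cases hi : i = k
    · subst hi
      simpa using contDiffOn_const
    · simpa [Matrix.updateRow_ne hi] using contDiffOn_mixedCoeff g φ hφ i l
  have hd := hdet _ (contDiffOn_mixedCoeff g φ hφ)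
  refine ((hd.inv fun y hy => (isUnit_det_mixedCoeff g φ hφ hy).ne_zero).mul hadj).congr ?_
  intro y hy
  simp [Matrix.inv_def]

end HermitianMetric
-- Calculus of the operators `∂_j` and `∂̄_j`
section FrameDeriv

variable {a : Idx n} {f f' : (Fin n → ℂ) → ℂ} {x : Fin n → ℂ}

theorem frameDeriv_congr (h : f =ᶠ[nhds x] f') : frameDeriv a f x = frameDeriv a f' x := by
  simp only [frameDeriv, h.fderiv_eq]

@[simp]
theorem frameDeriv_const (c : ℂ) : frameDeriv a (fun _ => c) x = 0 := by
  simp [frameDeriv]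

theorem frameDeriv_sub (hf : DifferentiableAt ℝ f x) (hf' : DifferentiableAt ℝ f' x) :
    frameDeriv a (fun y => f y - f' y) x = frameDeriv a f x - frameDeriv a f' x := by
  simp only [frameDeriv, fderiv_fun_sub hf hf', _root_.sub_apply]
  ring

theorem frameDeriv_neg : frameDeriv a (fun y => -f y) x = -frameDeriv a f x := by
  simp only [frameDeriv, fderiv_fun_neg, _root_.neg_apply]
  ring

theorem frameDeriv_mul (hf : DifferentiableAt ℝ f x) (hf' : DifferentiableAt ℝ f' x) :
    frameDeriv a (fun y => f y * f' y) x =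
      frameDeriv a f x * f' x + f x * frameDeriv a f' x := by
  simp only [frameDeriv, fderiv_fun_mul hf hf', _root_.add_apply,
    _root_.smul_apply, smul_eq_mul]
  ring

theorem frameDeriv_const_mul (hf : DifferentiableAt ℝ f x) (c : ℂ) :
    frameDeriv a (fun y => c * f y) x = c * frameDeriv a f x := by
  rw [frameDeriv_mul (differentiableAt_const c) hf, frameDeriv_const, zero_mul, zero_add]

theorem frameDeriv_sum {ι : Type*} (s : Finset ι) {F : ι → (Fin n → ℂ) → ℂ}
    (hF : ∀ i ∈ s, DifferentiableAt ℝ (F i) x) :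
    frameDeriv a (fun y => ∑ i ∈ s, F i y) x = ∑ i ∈ s, frameDeriv a (F i) x := by
  simp only [frameDeriv, fderiv_fun_sum hF, _root_.sum_apply, Finset.mul_sum,
    ← Finset.sum_sub_distrib, Finset.sum_div]

theorem contDiffAt_fderiv_apply (hf : ContDiffAt ℝ ∞ f x) (v : Fin n → ℂ) :
    ContDiffAt ℝ ∞ (fun y => fderiv ℝ f y v) x :=
  (hf.fderiv_right (m := ∞) (by simp)).clm_apply contDiffAt_const

theorem contDiffAt_frameDeriv (a : Idx n) (hf : ContDiffAt ℝ ∞ f x) :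
    ContDiffAt ℝ ∞ (frameDeriv a f) x :=
  ((contDiffAt_fderiv_apply hf _).sub
    (contDiffAt_const.mul (contDiffAt_fderiv_apply hf _))).div_const _

theorem fderiv_frameDeriv_apply (hf : ContDiffAt ℝ ∞ f x) (v : Fin n → ℂ) :
    fderiv ℝ (frameDeriv a f) x v =
      (fderiv ℝ (fderiv ℝ f) x v (xVec a) - jEig a * fderiv ℝ (fderiv ℝ f) x v (yVec a)) / 2 := by
  have hd : DifferentiableAt ℝ (fderiv ℝ f) x :=
    (hf.fderiv_right (m := ∞) (by simp)).differentiableAt (by simp)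
  have key : ∀ w, HasFDerivAt (fun y => fderiv ℝ f y w)
      ((fderiv ℝ (fderiv ℝ f) x).flip w) x := fun w => by
    have := hd.hasFDerivAt.clm_apply (hasFDerivAt_const w x)
    refine this.congr_fderiv ?_
    ext u
    simp
  have h := ((key (xVec a)).sub ((key (yVec a)).const_mul (jEig a))).mul_const (2⁻¹ : ℂ)
  have h' : HasFDerivAt (frameDeriv a f) _ x := h
  rw [h'.fderiv]
  simp
  ring

/-- The frame vectors have constant coefficients, so this is the symmetry of the real second
derivative. -/
theorem frameDeriv_comm (a b : Idx n) (hf : ContDiffAt ℝ ∞ f x) :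
    frameDeriv a (frameDeriv b f) x = frameDeriv b (frameDeriv a f) x := by
  have hs : IsSymmSndFDerivAt ℝ f x := hf.isSymmSndFDerivAt (by
    simpa using (WithTop.coe_le_coe.mpr le_top :
      ((2 : ℕ∞) : WithTop ℕ∞) ≤ ((⊤ : ℕ∞) : WithTop ℕ∞)))
  have key : ∀ (a b : Idx n), frameDeriv a (frameDeriv b f) x =
      (fderiv ℝ (frameDeriv b f) x (xVec a) - jEig a * fderiv ℝ (frameDeriv b f) x (yVec a)) / 2 :=
    fun _ _ => rfl
  rw [key, key]
  simp only [fderiv_frameDeriv_apply hf]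
  rw [hs.eq (xVec b) (xVec a), hs.eq (xVec b) (yVec a), hs.eq (yVec b) (xVec a),
    hs.eq (yVec b) (yVec a)]
  ring

end FrameDeriv

/-! ### Derivatives of matrix-valued functions -/

section FrameDerivMatrix

variable {m p q : Type*} {a : Idx n} {x : Fin n → ℂ}

/-- The entrywise derivative of a matrix of functions along a frame vector. -/
def frameDerivMatrix (a : Idx n) (A : (Fin n → ℂ) → Matrix m p ℂ) (x : Fin n → ℂ) :
    Matrix m p ℂ :=
  Matrix.of fun i j => frameDeriv a (fun y => A y i j) x

theorem frameDerivMatrix_congr {A B : (Fin n → ℂ) → Matrix m p ℂ} (h : A =ᶠ[nhds x] B) :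
    frameDerivMatrix a A x = frameDerivMatrix a B x := by
  ext i j
  exact frameDeriv_congr (h.mono fun y hy => congrFun (congrFun hy i) j)

theorem frameDerivMatrix_const (A : Matrix m p ℂ) :
    frameDerivMatrix a (fun _ => A) x = 0 := by
  ext i j
  simp [frameDerivMatrix]

theorem frameDerivMatrix_mul [Fintype p] {A : (Fin n → ℂ) → Matrix m p ℂ}
    {B : (Fin n → ℂ) → Matrix p q ℂ} (hA : ∀ i j, DifferentiableAt ℝ (fun y => A y i j) x)
    (hB : ∀ i j, DifferentiableAt ℝ (fun y => B y i j) x) :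
    frameDerivMatrix a (fun y => A y * B y) x =
      frameDerivMatrix a A x * B x + A x * frameDerivMatrix a B x := by
  ext i j
  simp only [frameDerivMatrix, Matrix.of_apply, Matrix.mul_apply, Matrix.add_apply]
  rw [frameDeriv_sum _ fun k _ => (hA i k).fun_mul (hB k j), ← Finset.sum_add_distrib]
  exact Finset.sum_congr rfl fun k _ => frameDeriv_mul (hA i k) (hB k j)

theorem differentiableAt_matrix_mul [Fintype p] {A : (Fin n → ℂ) → Matrix m p ℂ}
    {B : (Fin n → ℂ) → Matrix p q ℂ} (hA : ∀ i j, DifferentiableAt ℝ (fun y => A y i j) x)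
    (hB : ∀ i j, DifferentiableAt ℝ (fun y => B y i j) x) (i : m) (j : q) :
    DifferentiableAt ℝ (fun y => (A y * B y) i j) x := by
  simp only [Matrix.mul_apply]
  exact DifferentiableAt.fun_sum fun k _ => (hA i k).mul (hB k j)

theorem frameDerivMatrix_inv [Fintype m] [DecidableEq m] {A : (Fin n → ℂ) → Matrix m m ℂ}
    (hA : ∀ i j, DifferentiableAt ℝ (fun y => A y i j) x)
    (hA' : ∀ i j, DifferentiableAt ℝ (fun y => (A y)⁻¹ i j) x)
    (hu : ∀ᶠ y in nhds x, IsUnit (A y).det) :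
    frameDerivMatrix a (fun y => (A y)⁻¹) x =
      -((A x)⁻¹ * frameDerivMatrix a A x * (A x)⁻¹) := by
  have h1 : frameDerivMatrix a (fun y => A y * (A y)⁻¹) x = 0 := by
    rw [← frameDerivMatrix_const (a := a) (x := x) (1 : Matrix m m ℂ)]
    exact frameDerivMatrix_congr (hu.mono fun y hy => Matrix.mul_nonsing_inv _ hy)
  rw [frameDerivMatrix_mul hA hA'] at h1
  have h2 := congrArg ((A x)⁻¹ * ·) h1
  simp only [mul_add, mul_zero, ← mul_assoc, Matrix.nonsing_inv_mul _ hu.self_of_nhds,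
    one_mul] at h2
  exact eq_neg_of_add_eq_zero_right h2

/-- Both derivatives of the inverse are pulled inside the outer factors, so that the torsion side
can later be compared with the curvature before any index is raised. -/
theorem frameDerivMatrix_congruence [Fintype m] [DecidableEq m]
    {A T : (Fin n → ℂ) → Matrix m m ℂ}
    (hA : ∀ i j, DifferentiableAt ℝ (fun y => A y i j) x)
    (hA' : ∀ i j, DifferentiableAt ℝ (fun y => (A y)⁻¹ i j) x)
    (hT : ∀ i j, DifferentiableAt ℝ (fun y => T y i j) x)
    (hu : ∀ᶠ y in nhds x, IsUnit (A y).det) :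
    frameDerivMatrix a (fun y => (A y)⁻¹ * T y * (A y)⁻¹.transpose) x =
      (A x)⁻¹ * (frameDerivMatrix a T x - frameDerivMatrix a A x * (A x)⁻¹ * T x
        - T x * (frameDerivMatrix a A x * (A x)⁻¹).transpose) * (A x)⁻¹.transpose := by
  have ht : frameDerivMatrix a (fun y => (A y)⁻¹.transpose) x =
      (frameDerivMatrix a (fun y => (A y)⁻¹) x).transpose := rfl
  rw [frameDerivMatrix_mul (B := fun y => (A y)⁻¹.transpose)
    (differentiableAt_matrix_mul hA' hT) (fun i j => hA' j i),
    frameDerivMatrix_mul hA' hT, ht, frameDerivMatrix_inv hA hA' hu]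
  simp only [Matrix.transpose_neg, Matrix.transpose_mul, mul_sub, sub_mul, add_mul, neg_mul,
    mul_neg, mul_assoc]
  abel

end FrameDerivMatrix

/-- The quadratic terms in the curvature of the anticanonical bundle agree with those of the
torsion bivector: `P c` stands for the derivative of the Hermitian matrix along `∂_c` and `K` for
its inverse. -/
theorem sum_torsion_quadratic {ι : Type*} [Fintype ι] (K : Matrix ι ι ℂ) (P : ι → Matrix ι ι ℂ)
    (d e : ι) :
    ∑ k, ∑ c, K k c * (∑ f, (P c * K) d f * (P f e k - P e f k)
        + ∑ f, (P d f k - P f d k) * (P c * K) e f) =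
      -- Of the four products on the left, `h1` turns the two containing `P d` or `P e` into the
      -- right side; `h2` cancels the other two.
      ∑ j, ∑ l, ((K * P d * K) l j * P j e l - (K * P e * K) l j * P j d l) := by
  have h1 : ∀ u v : ι, ∑ k, ∑ c, K k c * ∑ f, (P c * K) u f * P v f k =
      ∑ j, ∑ l, (K * P v * K) l j * P j u l := by
    intro u v
    rw [Finset.sum_comm]
    refine Finset.sum_congr rfl fun c _ => ?_
    simp only [Matrix.mul_apply, Finset.mul_sum, Finset.sum_mul]
    rw [Finset.sum_comm]
    conv_lhs => enter [2, f]; rw [Finset.sum_comm]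
    rw [Finset.sum_comm]
    refine Finset.sum_congr rfl fun i _ => ?_
    rw [Finset.sum_comm]
    exact Finset.sum_congr rfl fun k _ => Finset.sum_congr rfl fun f _ => by ring
  -- Each side is a cyclic contraction of four matrix factors; reversing the order of the four
  -- summation indices exchanges `d` and `e`.
  have h2 : ∑ k, ∑ c, K k c * ∑ f, (P c * K) d f * P f e k =
      ∑ k, ∑ c, K k c * ∑ f, (P c * K) e f * P f d k := by
    have h := Fintype.sum_equiv
      (⟨fun z => (z.2.2.2, z.2.2.1, z.2.1, z.1), fun z => (z.2.2.2, z.2.2.1, z.2.1, z.1),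
        fun _ => rfl, fun _ => rfl⟩ : ι × ι × ι × ι ≃ ι × ι × ι × ι)
      (fun z => K z.1 z.2.1 * (P z.2.1 d z.2.2.2 * K z.2.2.2 z.2.2.1 * P z.2.2.1 e z.1))
      (fun z => K z.1 z.2.1 * (P z.2.1 e z.2.2.2 * K z.2.2.2 z.2.2.1 * P z.2.2.1 d z.1))
      (fun z => by simp only [Equiv.coe_fn_mk]; ring)
    simpa only [Fintype.sum_prod_type, Matrix.mul_apply, Finset.mul_sum, Finset.sum_mul] using h
  have h3 : ∀ k c, K k c * (∑ f, (P c * K) d f * (P f e k - P e f k)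
        + ∑ f, (P d f k - P f d k) * (P c * K) e f) =
      K k c * ∑ f, (P c * K) d f * P f e k - K k c * ∑ f, (P c * K) d f * P e f k
      + K k c * ∑ f, (P c * K) e f * P d f k - K k c * ∑ f, (P c * K) e f * P f d k := by
    intro k c
    simp only [mul_sub, sub_mul, Finset.sum_sub_distrib, mul_comm (P d _ _), mul_comm (P _ d _)]
    ring
  simp only [h3, Finset.sum_add_distrib, Finset.sum_sub_distrib]
  rw [h1, h1, h2]
  ring

/-! ### The form `∂ω` and the Chern torsion -/

namespace HermitianMetric

variable {M : Type*} [TopologicalSpace M] [ChartedSpace (Fin n → ℂ) M]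
  (g : HermitianMetric n M) (φ : OpenPartialHomeomorph M (Fin n → ℂ))

/-- The components `∂_d h_{e k̄} - ∂_e h_{d k̄}` of the torsion of the Chern connection. -/
def chernTorsion (k : Fin n) (y : Fin n → ℂ) : Matrix (Fin n) (Fin n) ℂ :=
  Matrix.of fun d e => frameDeriv (Sum.inl d) (fun z => g.mixedCoeff φ z e k) y -
    frameDeriv (Sum.inl e) (fun z => g.mixedCoeff φ z d k) y

theorem hermitianForm_inl_inr (j k : Fin n) :
    (fun y => g.hermitianForm φ y (Sum.inl j) (Sum.inr k)) =
    fun y => Complex.I * g.mixedCoeff φ y j k := rfl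

theorem hermitianForm_inr_inl (j k : Fin n) :
    (fun y => g.hermitianForm φ y (Sum.inr k) (Sum.inl j)) =
    fun y => -Complex.I * g.mixedCoeff φ y j k := by
  ext y
  simp [hermitianForm, jEig, coeff_inr_inl]

theorem hermitianForm_inl_inl (j k : Fin n) :
    (fun y => g.hermitianForm φ y (Sum.inl j) (Sum.inl k)) =
    fun _ => 0 := by
  ext y
  simp [hermitianForm, coeff_inl_inl]

section

variable {g φ} {x : Fin n → ℂ}
  (hH : ∀ i j, DifferentiableAt ℝ (fun y => g.mixedCoeff φ y i j) x)

include hH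

theorem dOmega_inl_inl_inr (d e k : Fin n) :
    g.dOmega φ x (Sum.inl d) (Sum.inl e) (Sum.inr k) =
      Complex.I * g.chernTorsion φ k x d e := by
  simp only [dOmega, hermitianForm_inl_inr, hermitianForm_inl_inl, frameDeriv_const,
    frameDeriv_const_mul (hH _ _), chernTorsion, Matrix.of_apply]
  ring

theorem dOmega_inr_inl_inl (d e k : Fin n) :
    g.dOmega φ x (Sum.inr k) (Sum.inl d) (Sum.inl e) =
      Complex.I * g.chernTorsion φ k x d e := by
  simp only [dOmega, hermitianForm_inr_inl, hermitianForm_inl_inl, frameDeriv_const,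
    frameDeriv_const_mul (hH _ _), chernTorsion, Matrix.of_apply]
  ring

/-- `∂̄_k` fills the only (0,1)-slot of `∂ω`, so the contraction has type (2,0); the sign is `i ·
i`. -/
theorem delOmega_inr (k : Fin n) (a b : Idx n) :
    Complex.I * g.delOmega φ x (Sum.inr k) a b =
      Matrix.fromBlocks (-g.chernTorsion φ k x) 0 0 0 a b := by
  rcases a with d | d <;> rcases b with e | e <;> simp [delOmega]
  rw [dOmega_inr_inl_inl hH, ← mul_assoc, Complex.I_mul_I, neg_one_mul]

end

/-! ### The torsion bivector and the curvature in terms of `mixedCoeff` -/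

section Smooth

variable {g φ} (hφ : φ ∈ IsManifold.maximalAtlas 𝓘(ℂ, Fin n → ℂ) ω M) {x : Fin n → ℂ}
  (hx : x ∈ φ.target)
include hφ hx

theorem contDiffAt_mixedCoeff (i j : Fin n) :
    ContDiffAt ℝ ∞ (fun y => g.mixedCoeff φ y i j) x :=
  (contDiffOn_mixedCoeff g φ hφ i j).contDiffAt (φ.open_target.mem_nhds hx)

theorem differentiableAt_mixedCoeff (i j : Fin n) :
    DifferentiableAt ℝ (fun y => g.mixedCoeff φ y i j) x :=
  (contDiffAt_mixedCoeff hφ hx i j).differentiableAt (by simp)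

theorem differentiableAt_frameDeriv_mixedCoeff (a : Idx n) (i j : Fin n) :
    DifferentiableAt ℝ (frameDeriv a fun y => g.mixedCoeff φ y i j) x :=
  (contDiffAt_frameDeriv a (contDiffAt_mixedCoeff hφ hx i j)).differentiableAt (by simp)

theorem differentiableAt_chernTorsion (k i j : Fin n) :
    DifferentiableAt ℝ (fun y => g.chernTorsion φ k y i j) x :=
  (differentiableAt_frameDeriv_mixedCoeff hφ hx _ _ _).sub
    (differentiableAt_frameDeriv_mixedCoeff hφ hx _ _ _)

variable [IsManifold 𝓘(ℂ, Fin n → ℂ) ω M]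

theorem contDiffAt_inv_mixedCoeff (i j : Fin n) :
    ContDiffAt ℝ ∞ (fun y => (g.mixedCoeff φ y)⁻¹ i j) x :=
  (contDiffOn_inv_mixedCoeff g φ hφ i j).contDiffAt (φ.open_target.mem_nhds hx)

theorem differentiableAt_inv_mixedCoeff (i j : Fin n) :
    DifferentiableAt ℝ (fun y => (g.mixedCoeff φ y)⁻¹ i j) x :=
  (contDiffAt_inv_mixedCoeff hφ hx i j).differentiableAt (by simp)

theorem raise_fromBlocks (A : Matrix (Fin n) (Fin n) ℂ) :
    g.raise φ x (Matrix.fromBlocks A 0 0 0) = Matrix.fromBlocks 0 0 0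
      ((g.mixedCoeff φ x)⁻¹ * A * (g.mixedCoeff φ x)⁻¹.transpose) := by
  ext (a | a) (b | b) <;>
    simp [raise, invCoeff_inl_inl g φ hφ hx, invCoeff_inr_inl g φ hφ hx, Matrix.mul_apply,
      Finset.sum_mul]
  rw [Finset.sum_comm]
  exact Finset.sum_congr rfl fun _ _ => Finset.sum_congr rfl fun _ _ => by ring

theorem torsionBivectorAlong_eq (k : Fin n) :
    g.torsionBivectorAlong φ k x = Matrix.fromBlocks 0 0 0
      (-((g.mixedCoeff φ x)⁻¹ * g.chernTorsion φ k x * (g.mixedCoeff φ x)⁻¹.transpose)) := by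
  have h : (fun a b => Complex.I * g.delOmega φ x (Sum.inr k) a b) =
      Matrix.fromBlocks (-g.chernTorsion φ k x) 0 0 0 := by
    ext a b
    exact delOmega_inr (differentiableAt_mixedCoeff hφ hx) k a b
  rw [torsionBivectorAlong, h, raise_fromBlocks hφ hx, mul_neg, neg_mul]

theorem frameDerivMatrix_torsionBivector (c k : Fin n) :
    frameDerivMatrix (Sum.inl c) (fun y => (g.mixedCoeff φ y)⁻¹ * g.chernTorsion φ k y *
        (g.mixedCoeff φ y)⁻¹.transpose) x =
      (g.mixedCoeff φ x)⁻¹ * (frameDerivMatrix (Sum.inl c) (g.chernTorsion φ k) x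
        - frameDerivMatrix (Sum.inl c) (g.mixedCoeff φ) x * (g.mixedCoeff φ x)⁻¹ *
          g.chernTorsion φ k x
        - g.chernTorsion φ k x * (frameDerivMatrix (Sum.inl c) (g.mixedCoeff φ) x *
          (g.mixedCoeff φ x)⁻¹).transpose) * (g.mixedCoeff φ x)⁻¹.transpose :=
  frameDerivMatrix_congruence (differentiableAt_mixedCoeff hφ hx)
    (differentiableAt_inv_mixedCoeff hφ hx) (differentiableAt_chernTorsion hφ hx k)
    (Filter.eventually_of_mem (φ.open_target.mem_nhds hx) fun _ hy =>
      isUnit_det_mixedCoeff g φ hφ hy)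

/-- The terms of the bracket that differentiate the vector field drop out: its (0,1)-components
vanish on the whole chart, not only at `x`. -/
theorem schouten_inr_inr (k a b : Fin n) :
    schouten (g.sharpDzBar φ k) (g.torsionBivectorAlong φ k) x (Sum.inr a) (Sum.inr b) =
      -∑ c, (g.mixedCoeff φ x)⁻¹ k c * frameDerivMatrix (Sum.inl c) (fun y =>
        (g.mixedCoeff φ y)⁻¹ * g.chernTorsion φ k y * (g.mixedCoeff φ y)⁻¹.transpose) x a b := by
  have hmem := φ.open_target.mem_nhds hx
  have hw : ∀ c a, frameDeriv c (fun y => g.sharpDzBar φ k y (Sum.inr a)) x = 0 := fun c a => by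
    rw [frameDeriv_congr (f' := fun _ => 0), frameDeriv_const]
    exact Filter.eventually_of_mem hmem fun y hy => invCoeff_inr_inr g φ hφ hy a k
  have hβ : ∀ c, frameDeriv c (fun y => g.torsionBivectorAlong φ k y (Sum.inr a) (Sum.inr b)) x =
      -frameDerivMatrix c (fun y => (g.mixedCoeff φ y)⁻¹ * g.chernTorsion φ k y *
        (g.mixedCoeff φ y)⁻¹.transpose) x a b := fun c => by
    simp only [frameDerivMatrix, Matrix.of_apply]
    rw [← frameDeriv_neg]
    refine frameDeriv_congr (Filter.eventually_of_mem hmem fun y hy => ?_)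
    simp only [torsionBivectorAlong_eq hφ hy]
    rfl
  simp only [schouten, hw, hβ]
  simp only [Fintype.sum_sum_type, sharpDzBar, invCoeff_inr_inr g φ hφ hx,
    invCoeff_inl_inr g φ hφ hx, mul_zero, sub_zero, zero_mul, Finset.sum_const_zero, add_zero,
    mul_neg, Finset.sum_neg_distrib]

theorem torsionBivector_eq :
    g.torsionBivector φ x = Matrix.fromBlocks 0 0 0 (-((g.mixedCoeff φ x)⁻¹ *
      (∑ k, ∑ c, (g.mixedCoeff φ x)⁻¹ k c • (frameDerivMatrix (Sum.inl c) (g.chernTorsion φ k) x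
        - frameDerivMatrix (Sum.inl c) (g.mixedCoeff φ) x * (g.mixedCoeff φ x)⁻¹ *
          g.chernTorsion φ k x
        - g.chernTorsion φ k x * (frameDerivMatrix (Sum.inl c) (g.mixedCoeff φ) x *
          (g.mixedCoeff φ x)⁻¹).transpose)) * (g.mixedCoeff φ x)⁻¹.transpose)) := by
  ext (a | a) (b | b)
  · simp [torsionBivector, part02]
  · simp [torsionBivector, part02]
  · simp [torsionBivector, part02]
  · simp only [torsionBivector, part02, Sum.isRight_inr, and_self, if_true,
      schouten_inr_inr hφ hx, frameDerivMatrix_torsionBivector hφ hx, Matrix.fromBlocks_apply₂₂,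
      Finset.mul_sum, Finset.sum_mul, Matrix.neg_apply, Matrix.sum_apply,
      Matrix.mul_smul, Matrix.smul_mul, Matrix.smul_apply, smul_eq_mul, Finset.sum_neg_distrib]

/-- With `u = ∂_a H j l` and `v = ∂_j H a l`, the Levi-Civita part contributes `(u + v)/2` and the
torsion part `-(u - v)/2`, leaving `v`. -/
theorem anticanonicalForm_inl (a : Fin n) :
    g.anticanonicalForm φ x (Sum.inl a) = ∑ j, ∑ l, (g.mixedCoeff φ x)⁻¹ l j *
      frameDeriv (Sum.inl j) (fun y => g.mixedCoeff φ y a l) x := by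
  refine Finset.sum_congr rfl fun j _ => ?_
  simp only [bismut, leviCivita, Fintype.sum_sum_type, invCoeff_inl_inl g φ hφ hx,
    invCoeff_inl_inr g φ hφ hx, zero_mul, Finset.sum_const_zero, zero_add, coeff_inl_inl,
    coeff_inl_inr, frameDeriv_const, dcOmega, dOmega_inl_inl_inr (differentiableAt_mixedCoeff hφ hx),
    jEig, Sum.elim_inl, Sum.elim_inr, Finset.mul_sum, ← Finset.sum_sub_distrib, chernTorsion,
    Matrix.of_apply]
  refine Finset.sum_congr rfl fun l _ => ?_
  set u := frameDeriv (Sum.inl a) (fun y => g.mixedCoeff φ y j l) x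
  set v := frameDeriv (Sum.inl j) (fun y => g.mixedCoeff φ y a l) x
  linear_combination (-(1 / 2) * (g.mixedCoeff φ x)⁻¹ l j * (u - v) *
    (Complex.I * Complex.I - 1)) * Complex.I_mul_I

theorem frameDeriv_anticanonicalForm (d a : Fin n) :
    frameDeriv (Sum.inl d) (fun y => g.anticanonicalForm φ y (Sum.inl a)) x =
      ∑ j, ∑ l, (-((g.mixedCoeff φ x)⁻¹ * frameDerivMatrix (Sum.inl d) (g.mixedCoeff φ) x *
          (g.mixedCoeff φ x)⁻¹) l j * frameDeriv (Sum.inl j) (fun y => g.mixedCoeff φ y a l) x +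
        (g.mixedCoeff φ x)⁻¹ l j * frameDeriv (Sum.inl d)
          (frameDeriv (Sum.inl j) fun y => g.mixedCoeff φ y a l) x) := by
  have hmem := φ.open_target.mem_nhds hx
  have hK := differentiableAt_inv_mixedCoeff (g := g) hφ hx
  have hP := differentiableAt_frameDeriv_mixedCoeff (g := g) hφ hx
  have hinv := frameDerivMatrix_inv (a := Sum.inl d) (differentiableAt_mixedCoeff (g := g) hφ hx)
    hK (Filter.eventually_of_mem hmem fun _ hy => isUnit_det_mixedCoeff g φ hφ hy)
  rw [frameDeriv_congr (Filter.eventually_of_mem hmem fun y hy => anticanonicalForm_inl hφ hy a),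
    frameDeriv_sum _ fun j _ => DifferentiableAt.fun_sum fun l _ => (hK l j).fun_mul (hP _ a l)]
  refine Finset.sum_congr rfl fun j _ => ?_
  rw [frameDeriv_sum _ fun l _ => (hK l j).fun_mul (hP _ a l)]
  refine Finset.sum_congr rfl fun l _ => ?_
  rw [frameDeriv_mul (hK l j) (hP _ a l)]
  congr 2
  exact congrFun (congrFun hinv l) j

/-- The core of the theorem: the (2,0)-curvature is the matrix that `torsionBivector_eq` places
between the two inverse factors. -/
theorem anticanonicalCurvature_inl_inl (d e : Fin n) :
    g.anticanonicalCurvature φ x (Sum.inl d) (Sum.inl e) =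
      (∑ k, ∑ c, (g.mixedCoeff φ x)⁻¹ k c • (frameDerivMatrix (Sum.inl c) (g.chernTorsion φ k) x
        - frameDerivMatrix (Sum.inl c) (g.mixedCoeff φ) x * (g.mixedCoeff φ x)⁻¹ *
          g.chernTorsion φ k x
        - g.chernTorsion φ k x * (frameDerivMatrix (Sum.inl c) (g.mixedCoeff φ) x *
          (g.mixedCoeff φ x)⁻¹).transpose)) d e := by
  have hquad := sum_torsion_quadratic (g.mixedCoeff φ x)⁻¹
    (fun c => frameDerivMatrix (Sum.inl c) (g.mixedCoeff φ) x) d e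
  have hP := differentiableAt_frameDeriv_mixedCoeff (g := g) hφ hx
  -- Commuting derivatives puts `∂_c` innermost, as in the derivative of `anticanonicalForm`.
  have hT : ∀ c k, frameDerivMatrix (Sum.inl c) (g.chernTorsion φ k) x d e =
      frameDeriv (Sum.inl d) (frameDeriv (Sum.inl c) fun y => g.mixedCoeff φ y e k) x -
      frameDeriv (Sum.inl e) (frameDeriv (Sum.inl c) fun y => g.mixedCoeff φ y d k) x := by
    intro c k
    rw [frameDeriv_comm _ _ (contDiffAt_mixedCoeff hφ hx _ _),
      frameDeriv_comm (Sum.inl e) _ (contDiffAt_mixedCoeff hφ hx _ _),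
      ← frameDeriv_sub (hP _ _ _) (hP _ _ _)]
    rfl
  have hsplit : ∀ k c, (g.mixedCoeff φ x)⁻¹ k c •
      (frameDerivMatrix (Sum.inl c) (g.chernTorsion φ k) x
        - frameDerivMatrix (Sum.inl c) (g.mixedCoeff φ) x * (g.mixedCoeff φ x)⁻¹ *
          g.chernTorsion φ k x
        - g.chernTorsion φ k x * (frameDerivMatrix (Sum.inl c) (g.mixedCoeff φ) x *
          (g.mixedCoeff φ x)⁻¹).transpose) d e =
      (g.mixedCoeff φ x)⁻¹ k c * frameDerivMatrix (Sum.inl c) (g.chernTorsion φ k) x d e -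
      (g.mixedCoeff φ x)⁻¹ k c * (∑ f, (frameDerivMatrix (Sum.inl c) (g.mixedCoeff φ) x *
          (g.mixedCoeff φ x)⁻¹) d f * g.chernTorsion φ k x f e +
        ∑ f, g.chernTorsion φ k x d f * (frameDerivMatrix (Sum.inl c) (g.mixedCoeff φ) x *
          (g.mixedCoeff φ x)⁻¹) e f) := by
    intro k c
    simp only [Matrix.sub_apply, smul_eq_mul, Matrix.mul_apply (M := frameDerivMatrix _ _ _ * _),
      Matrix.mul_apply (M := g.chernTorsion φ k x), Matrix.transpose_apply]
    ring
  simp only [Matrix.sum_apply, Matrix.smul_apply, hsplit, Finset.sum_sub_distrib]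
  -- The entries of `chernTorsion` match `P f e k - P e f k` only after unfolding.
  erw [hquad]
  rw [Finset.sum_comm]
  simp only [hT, anticanonicalCurvature, frameDeriv_anticanonicalForm hφ hx]
  simp only [← Finset.sum_sub_distrib]
  refine Finset.sum_congr rfl fun j _ => Finset.sum_congr rfl fun l _ => ?_
  simp only [frameDerivMatrix, Matrix.of_apply]
  ring

end Smooth

end HermitianMetric

end HermitianGeometry

end

theorem mainTheorem9 (n : ℕ) (M : Type*) [TopologicalSpace M] [ChartedSpace (Fin n → ℂ) M]
    [IsManifold 𝓘(ℂ, Fin n → ℂ) ω M] (g : HermitianGeometry.HermitianMetric n M)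
    (φ : OpenPartialHomeomorph M (Fin n → ℂ))
    (hφ : φ ∈ IsManifold.maximalAtlas 𝓘(ℂ, Fin n → ℂ) ω M) (p : M) (hp : p ∈ φ.source) :
    g.torsionBivector φ (φ p) =
      Complex.I • g.raise φ (φ p) (HermitianGeometry.part20 (g.bismutRicci φ (φ p))) := by
  open HermitianGeometry HermitianMetric in
  have hx := φ.map_source hp
  have h : part20 (g.bismutRicci φ (φ p)) = Matrix.fromBlocks
      (Complex.I • Matrix.of fun d e =>
        g.anticanonicalCurvature φ (φ p) (Sum.inl d) (Sum.inl e)) 0 0 0 := by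
    ext (a | a) (b | b) <;> simp [part20, bismutRicci]
  have hF := Matrix.ext fun d e => (anticanonicalCurvature_inl_inl (g := g) hφ hx d e)
  -- Both sides become `-K F Kᵀ` in the (0,2)-block; on the right the sign is the factor `i` of the
  -- statement times the `i` in `ρ_B = iF`.
  rw [h, raise_fromBlocks hφ hx, torsionBivector_eq hφ hx, ← hF]
  change _ = Complex.I • (Matrix.fromBlocks _ _ _ _ : Matrix (Idx n) (Idx n) ℂ)
  rw [Matrix.fromBlocks_smul, smul_zero, Matrix.mul_smul, Matrix.smul_mul, smul_smul,
    Complex.I_mul_I, neg_one_smul]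
  rfl
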